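/- **Setting.** A tensor network is a (hyper)graph whose vertices are dense tensors and whose edges $e$ are tensor dimensions of size $\dim e\ge 1$; put $w(e)=\log\dim e$. For disjoint vertex sets $A,B$ let $\mathrm{cut}(A)$ be the total weight of the dimensions of the tensor obtained by contracting $A$, and let $\mathrm{cut}(A,B)$ be the total weight of the edges adjacent to both $A$ and $B$. The contraction $(A,B)$ costs $\exp(\mathrm{cut}(A)+\mathrm{cut}(B)-\mathrm{cut}(A,B))$, and the cost of a contraction tree is the sum of the costs of its contractions. *Data.* Let $N\ge 3$ and let $m<R<s$ be positive integers. The data $G_D$ is a tensor train with cores $v_1,\dots,v_N$: consecutive cores are joined by an edge of size $R$, and each core has one uncontracted edge of size $s$. The $N-1$ uncontracted edges at $v_1,\dots,v_{N-1}$ are to be sketched. The data contraction tree $T_0$ contracts from left to right, $(\cdots((v_1,v_2),v_3),\dots,v_N)$. *Embeddings.* An embedding $G_E$ is a tensor network on a graph, with $N_E$ vertices, attached to the data along the edges to be sketched. For an ordering (linearization) of its vertices, the row size at a vertex is the product of the sizes of the output edges at that vertex and of the embedding edges joining it to later vertices. Let $0<\epsilon,\delta<1$ and fix constants $c_0,C_1>0$.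 The embedding is *admissible* with sketch size $m$ if - for some ordering every row size is at least $c_0N_E\log(1/\delta)/\epsilon^2$ (the $(\epsilon,\delta)$-accurate sufficient condition), and - it has exactly one output edge, of size $m$, where $c_0N_E\log(1/\delta)/\epsilon^2\le m\le C_1N_E\log(1/\delta)/\epsilon^2$. A contraction tree $T_B$ of the whole network $(G_D,G_E)$ is *constrained on $T_0$* if for each contraction $(A,B)$ of $T_0$ there is a contraction $(\hat A,\hat B)$ of $T_B$ with $\hat A\cap V_D=A$ and $\hat B\cap V_D=B$ (the two operands of a contraction being unordered). *Randomize-then-Orthogonalize sketch.* The embedding is the tensor train with cores $u_1,\dots,u_{N-1}$, where $u_j$ is attached to $v_j$ by the sketched edge, consecutive cores are joined by an edge of size $m$, and $u_{N-1}$ carries the output edge of size $m$. The running tensor is contracted successively in the order $v_1,u_1,v_2,u_2,\dots,v_{N-1},u_{N-1},v_N$. **Theorem.** 1. For all $c_0,C_1>0$ there is a constant $c>0$, depending only on $c_0,C_1$, such that for all $N\ge 3$, $m<R<s$ and $\epsilon,\delta\in(0,1)$, every admissible embedding with sketch size $m$ and every contraction tree $T_B$ constrained on $T_0$, the cost of $T_B$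 is at least $c\,NsR^2m$; that is, it is $\Omega(NsR^2m)$. 2. The contraction tree of the Randomize-then-Orthogonalize sketch is constrained on $T_0$ and its cost is $\Theta(NsR^2m)$, with absolute constants. 3. Its embedding, which has $N_E=N-1$ vertices, is admissible for all $c_0,C_1>0$ and all $m$ with $c_0N_E\log(1/\delta)/\epsilon^2\le m\le C_1N_E\log(1/\delta)/\epsilon^2$. 4. Hence the Randomize-then-Orthogonalize sketch is asymptotically optimal: for all $c_0,C_1>0$ there is a constant $K$, depending only on $c_0,C_1$, such that its cost is at most $K$ times the cost of any contraction tree constrained on $T_0$ with any admissible embedding with the same $N,s,R,m$. -/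

import Mathlib

universe u v

namespace TNSketch

/-- A tensor network on a hypergraph: `V` indexes the tensors, `E` the (hyper)edges.  An edge is
adjacent to the vertices in `ends e`; it is uncontracted when it also has a dangling end, and a
contracted edge is adjacent to at least two vertices.  `dim e` is the dimension size of `e`. -/
structure TensorNetwork (V : Type*) (E : Type*) where
  ends : E → Finset V
  dangling : E → Prop
  dim : E → ℕ+
  ends_nonempty : ∀ e, (ends e).Nonempty
  two_le_of_contracted : ∀ e, ¬ dangling e → 2 ≤ (ends e).card

namespace TensorNetwork

variable {V E : Type*} [Fintype V] [Fintype E]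

/-- `w(e)`, the natural logarithm of the dimension size. -/
noncomputable def weight (G : TensorNetwork V E) (e : E) : ℝ := Real.log ((G.dim e : ℕ) : ℝ)

open Classical in
/-- `E(A, B)`: the edges adjacent both to `A` and to `B`. -/
noncomputable def edgesBetween (G : TensorNetwork V E) (A B : Finset V) : Finset E :=
  {e | (∃ a ∈ A, a ∈ G.ends e) ∧ (∃ b ∈ B, b ∈ G.ends e)}

open Classical in
/-- `E(A, *)`: the uncontracted edges adjacent to vertices of `A` only. -/
noncomputable def edgesOpen (G : TensorNetwork V E) (A : Finset V) : Finset E :=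
  {e | G.dangling e ∧ G.ends e ⊆ A}

open Classical in
/-- `E(A) = E(A, V \ A) ∪ E(A, *)`: the dimensions of the tensor obtained by contracting `A`. -/
noncomputable def edgesOut (G : TensorNetwork V E) (A : Finset V) : Finset E :=
  G.edgesBetween A Aᶜ ∪ G.edgesOpen A

noncomputable def cutBetween (G : TensorNetwork V E) (A B : Finset V) : ℝ :=
  ∑ e ∈ G.edgesBetween A B, G.weight e

noncomputable def cut (G : TensorNetwork V E) (A : Finset V) : ℝ :=
  ∑ e ∈ G.edgesOut A, G.weight e

/-- Logarithm of the cost of contracting the dense tensors obtained from the disjoint sets `A` and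
`B` by classical matrix multiplication. -/
noncomputable def logCost (G : TensorNetwork V E) (A B : Finset V) : ℝ :=
  G.cut A + G.cut B - G.cutBetween A B

/-- The network is a graph: uncontracted edges are adjacent to one vertex, contracted edges to
two. -/
def IsGraph (G : TensorNetwork V E) : Prop :=
  ∀ e, (G.dangling e → (G.ends e).card = 1) ∧ (¬ G.dangling e → (G.ends e).card = 2)

end TensorNetwork

/-- Rooted binary trees with leaves labelled by single vertices. -/
inductive ContractionTree (V : Type*) where
  | leaf (v : V) : ContractionTree V
  | node (l r : ContractionTree V) : ContractionTree V

namespace ContractionTree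

variable {V : Type*}

open Classical in
/-- The set of vertices that the root of the tree represents. -/
noncomputable def verts : ContractionTree V → Finset V
  | leaf v => {v}
  | node l r => l.verts ∪ r.verts

/-- The contractions performed by the tree. -/
noncomputable def contractions : ContractionTree V → List (Finset V × Finset V)
  | leaf _ => []
  | node l r => (l.verts, r.verts) :: (l.contractions ++ r.contractions)

/-- `(A, B)` is a contraction of the tree; the two operands are unordered. -/
def HasContraction (T : ContractionTree V) (A B : Finset V) : Prop :=
  (A, B) ∈ T.contractions ∨ (B, A) ∈ T.contractions

/-- `T` fully contracts a network with vertex set `V`: the operands of each contraction are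
disjoint, and the root represents all of `V`. -/
def IsFull [Fintype V] (T : ContractionTree V) : Prop :=
  (∀ p ∈ T.contractions, Disjoint p.1 p.2) ∧ T.verts = Finset.univ

/-- Total cost: the sum of `exp (cost_G(A, B))` over all contractions `(A, B)` of the tree. -/
noncomputable def cost {E : Type*} [Fintype V] [Fintype E] (G : TensorNetwork V E)
    (T : ContractionTree V) : ℝ :=
  (T.contractions.map fun p => Real.exp (G.logCost p.1 p.2)).sum

/-- `T`, on data vertices `VD` and embedding vertices `VE`, is constrained on the data contraction
tree `T₀`.  Here `A.toLeft` is the intersection of `A` with the data vertices. -/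
def IsConstrainedOn {VD VE : Type*} (T : ContractionTree (VD ⊕ VE)) (T₀ : ContractionTree VD) :
    Prop :=
  ∀ A B : Finset VD, T₀.HasContraction A B →
    ∃ A' B' : Finset (VD ⊕ VE), T.HasContraction A' B' ∧ A'.toLeft = A ∧ B'.toLeft = B

end ContractionTree

section Sketching

variable {VD VE ι P F : Type*}

/-- The overall network `(G_D, G_E)`.  The type `ι` indexes the edges to be sketched; they occur as
dangling edges in the data network and in the embedding and become contracted edges here.  `P`
indexes the remaining data edges, `F` the remaining embedding edges. -/
def glue (D : TensorNetwork VD (ι ⊕ P)) (S : TensorNetwork VE (ι ⊕ F)) :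
    TensorNetwork (VD ⊕ VE) (ι ⊕ (P ⊕ F)) where
  ends
    | .inl i => (D.ends (.inl i)).disjSum (S.ends (.inl i))
    | .inr (.inl p) => (D.ends (.inr p)).disjSum ∅
    | .inr (.inr f) => (∅ : Finset VD).disjSum (S.ends (.inr f))
  dangling
    | .inl _ => False
    | .inr (.inl p) => D.dangling (.inr p)
    | .inr (.inr f) => S.dangling (.inr f)
  dim
    | .inl i => D.dim (.inl i)
    | .inr (.inl p) => D.dim (.inr p)
    | .inr (.inr f) => S.dim (.inr f)
  ends_nonempty := by
    rintro (i | p | f)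
    · have := (D.ends_nonempty (.inl i)).card_pos
      rw [← Finset.card_pos, Finset.card_disjSum]
      omega
    · have := (D.ends_nonempty (.inr p)).card_pos
      rw [← Finset.card_pos, Finset.card_disjSum]
      omega
    · have := (S.ends_nonempty (.inr f)).card_pos
      rw [← Finset.card_pos, Finset.card_disjSum]
      omega
  two_le_of_contracted := by
    rintro (i | p | f) h
    · have h1 := (D.ends_nonempty (.inl i)).card_pos
      have h2 := (S.ends_nonempty (.inl i)).card_pos
      rw [Finset.card_disjSum]
      omega
    · have := D.two_le_of_contracted (.inr p) h
      rw [Finset.card_disjSum]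
      omega
    · have := S.two_le_of_contracted (.inr f) h
      rw [Finset.card_disjSum]
      omega

/-- `S` is a (graph) embedding for the data `D`: it can be attached to `D` along the edges to be
sketched. -/
def IsEmbeddingFor (D : TensorNetwork VD (ι ⊕ P)) (S : TensorNetwork VE (ι ⊕ F)) : Prop :=
  S.IsGraph ∧ ∀ i, S.dangling (.inl i) ∧ S.dim (.inl i) = D.dim (.inl i)

/-- The only uncontracted embedding edge, other than the edges to be sketched, is one edge of
size `m`. -/
def HasSingleOutput (S : TensorNetwork VE (ι ⊕ F)) (m : ℕ+) : Prop :=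
  ∃ o : F, S.dim (.inr o) = m ∧ ∀ f, S.dangling (.inr f) ↔ f = o

open Classical in
/-- Row size of the matricization of the tensor at `v` in the linearization of the embedding given
by the vertex ordering `σ`: the rows collect the output dimensions at `v` and the dimensions shared
with later embedding vertices (the edges to be sketched belong to the columns). -/
noncomputable def rowSize [Fintype VE] [Fintype F] (S : TensorNetwork VE (ι ⊕ F))
    (σ : VE ≃ Fin (Fintype.card VE)) (v : VE) : ℕ :=
  ∏ f : F with v ∈ S.ends (.inr f) ∧
    (S.dangling (.inr f) ∨ ∃ x ∈ S.ends (.inr f), σ v < σ x), (S.dim (.inr f) : ℕ)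

/-- `N_E log(1/δ) / ε²`, with `N_E = k` embedding vertices. -/
noncomputable def accuracyScale (k : ℕ) (ε δ : ℝ) : ℝ := k * Real.log (1 / δ) / ε ^ 2

/-- The `(ε, δ)`-accurate sufficient condition, with the constant `c₀` in the `Ω`: in some
linearization every row size is at least `c₀ N_E log(1/δ) / ε²`. -/
def SufficientCondition [Fintype VE] [Fintype F] (c₀ ε δ : ℝ) (S : TensorNetwork VE (ι ⊕ F)) :
    Prop :=
  ∃ σ : VE ≃ Fin (Fintype.card VE), ∀ v : VE,
    c₀ * accuracyScale (Fintype.card VE) ε δ ≤ rowSize S σ v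

/-- The class of embeddings for `D` that satisfy the `(ε, δ)`-accurate sufficient condition and
have only one output sketch dimension, of size `m = Θ(N_E log(1/δ) / ε²)`.  The implied constants
are `c₀` (lower) and `C₁` (upper). -/
def Admissible [Fintype VE] [Fintype F] (c₀ C₁ ε δ : ℝ) (m : ℕ+)
    (D : TensorNetwork VD (ι ⊕ P)) (S : TensorNetwork VE (ι ⊕ F)) : Prop :=
  IsEmbeddingFor D S ∧ SufficientCondition c₀ ε δ S ∧ HasSingleOutput S m ∧
    c₀ * accuracyScale (Fintype.card VE) ε δ ≤ ((m : ℕ) : ℝ) ∧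
    ((m : ℕ) : ℝ) ≤ C₁ * accuracyScale (Fintype.card VE) ε δ

/-- `T` is a contraction tree of the whole network constrained on the data tree `T₀`. -/
def IsSketchingTree [Fintype VD] [Fintype VE] (T₀ : ContractionTree VD)
    (T : ContractionTree (VD ⊕ VE)) : Prop :=
  T.IsFull ∧ T.IsConstrainedOn T₀

end Sketching

/-- Tensor train of order `n + 1`, with all output dimensions of size `s` and rank `R`.  The edges
to be sketched are the output dimensions of all cores but the last; the other edges are the `n`
bonds and the output dimension of the last core. -/
def ttData (n : ℕ) (s R : ℕ+) : TensorNetwork (Fin (n + 1)) (Fin n ⊕ (Fin n ⊕ Unit)) where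
  ends
    | .inl j => {j.castSucc}
    | .inr (.inl j) => {j.castSucc, j.succ}
    | .inr (.inr _) => {Fin.last n}
  dangling
    | .inl _ => True
    | .inr (.inl _) => False
    | .inr (.inr _) => True
  dim
    | .inl _ => s
    | .inr (.inl _) => R
    | .inr (.inr _) => s
  ends_nonempty := by rintro (j | j | j) <;> simp
  two_le_of_contracted := by
    rintro (j | j | j) h
    · exact absurd trivial h
    · rw [Finset.card_pair (Fin.castSucc_lt_succ).ne]
    · exact absurd trivial h

/-- The left-to-right data contraction tree `((v₁, v₂), v₃), …, v_{n+1})`. -/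
def leftToRight (n : ℕ) : ContractionTree (Fin (n + 1)) :=
  (List.finRange n).foldl (fun t j => .node t (.leaf j.succ)) (.leaf 0)

/-- Tensor train embedding with `n` cores and rank `m`.  Embedding edge `j` joins the cores `j` and
`j + 1`, except for the last one, which is the output dimension of the last core. -/
def ttEmbedding (n : ℕ) (s m : ℕ+) : TensorNetwork (Fin n) (Fin n ⊕ Fin n) where
  ends
    | .inl j => {j}
    | .inr j => {x | x = j ∨ (x : ℕ) = j + 1}
  dangling
    | .inl _ => True
    | .inr j => (j : ℕ) + 1 = n
  dim
    | .inl _ => s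
    | .inr _ => m
  ends_nonempty := by
    rintro (j | j)
    · simp
    · exact ⟨j, by simp⟩
  two_le_of_contracted := by
    rintro (j | j) h
    · exact absurd trivial h
    · have hj : (j : ℕ) + 1 < n := lt_of_le_of_ne j.2 h
      refine Finset.one_lt_card.2 ⟨j, by simp, ⟨j + 1, hj⟩, by simp, ?_⟩
      simp [Fin.ext_iff]

/-- The contraction order of the randomized sketching step of "Randomize-then-Orthogonalize": the
running tensor is contracted alternately with the next embedding core and the next data core, that
is, in the order `v₁, u₁, v₂, u₂, …, v_n, u_n, v_{n+1}`. -/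
def rtoTree (n : ℕ) : ContractionTree (Fin (n + 1) ⊕ Fin n) :=
  (List.finRange n).foldl
    (fun t j => .node (.node t (.leaf (.inr j))) (.leaf (.inl j.succ))) (.leaf (.inl 0))

/-- Cost of that sketching step. -/
noncomputable def rtoCost (n : ℕ) (s R m : ℕ+) : ℝ :=
  (rtoTree n).cost (glue (ttData n s R) (ttEmbedding n s m))

/-- `N s R² m` for order `N = n + 1`. -/
noncomputable def ttRate (n : ℕ) (s R m : ℕ+) : ℝ :=
  ((n : ℝ) + 1) * ((s : ℕ) : ℝ) * ((R : ℕ) : ℝ) ^ 2 * ((m : ℕ) : ℝ)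

end TNSketch

/-! The lower bound rests on one expensive contraction per interior core, of cost at least `s R² x`,
where `x = (c₀ / C₁) m` lies below `m` and below every row size. Let `v` be such a core. The data
tree multiplies the product of the earlier cores by `v`, so a constrained tree contracts some `A`
and `B` whose data parts are the earlier cores and `v` alone. Both bonds at `v` leave any set whose
only data vertex is `v`, which gives `R²`.

The factor `s` is the sketched edge at `v`, with embedding end `w`. If `w` lies outside `B`, this
edge leaves `B`. If `w` lies in `B`, some contraction in the subtree of `B` separates `v` from `w`;
the edge leaves the side of `v`, and the other side contains no data vertex. The factor `x` is a
row: among the embedding vertices of a set, the row of the last one consists of dimensions leaving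
that set (`exists_row_subset_edgesOut`). The only case without a row at hand is an `A` that misses
the embedding end of the first sketched edge; then that edge leaves `A` and contributes a second
`s`, which exceeds `m`.

The largest data core among the operands identifies `v`, so different cores give different
contractions and the costs add up (`card_mul_le_cost`, `ttRate_le_cost`).

For the upper bound, Randomize-then-Orthogonalize makes `2n` contractions. Absorbing an embedding
core costs at most `s R m²`, absorbing a data core at most `s R² m`, and `m < R` puts both below `s
R² m`. The sketch is itself admissible, so its own lower bound is an instance of the general one,
and optimality is the quotient of the two bounds. -/

namespace TNSketch

/-! ### Cuts and the cost of a single contraction -/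

namespace TensorNetwork

variable {V E : Type*}

lemma one_le_dim (G : TensorNetwork V E) (e : E) : (1 : ℝ) ≤ ((G.dim e : ℕ) : ℝ) := by
  exact_mod_cast (G.dim e).pos

lemma weight_nonneg (G : TensorNetwork V E) (e : E) : 0 ≤ G.weight e :=
  Real.log_nonneg (G.one_le_dim e)

lemma exp_sum_weight (G : TensorNetwork V E) (Q : Finset E) :
    Real.exp (∑ e ∈ Q, G.weight e) = ∏ e ∈ Q, ((G.dim e : ℕ) : ℝ) := by
  rw [Real.exp_sum]
  exact Finset.prod_congr rfl fun e _ => Real.exp_log (zero_lt_one.trans_le (G.one_le_dim e))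

variable [Fintype E]

lemma mem_edgesBetween {G : TensorNetwork V E} {A B : Finset V} {e : E} :
    e ∈ G.edgesBetween A B ↔ (∃ a ∈ A, a ∈ G.ends e) ∧ ∃ b ∈ B, b ∈ G.ends e := by
  simp [edgesBetween]

lemma edgesBetween_comm (G : TensorNetwork V E) (A B : Finset V) :
    G.edgesBetween A B = G.edgesBetween B A := by
  ext e
  simp only [mem_edgesBetween, and_comm]

lemma mem_edgesBetween_single {G : TensorNetwork V E} {A B : Finset V} {e : E} {a : V}
    (h : ∀ y, y ∈ G.ends e ↔ y = a) : e ∈ G.edgesBetween A B ↔ a ∈ A ∧ a ∈ B := by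
  simp [mem_edgesBetween, h]

lemma mem_edgesBetween_pair {G : TensorNetwork V E} {A B : Finset V} {e : E} {a b : V}
    (h : ∀ y, y ∈ G.ends e ↔ y = a ∨ y = b) :
    e ∈ G.edgesBetween A B ↔ (a ∈ A ∨ b ∈ A) ∧ (a ∈ B ∨ b ∈ B) := by
  simp [mem_edgesBetween, h, and_or_left, exists_or]

variable [Fintype V]

lemma mem_edgesOut {G : TensorNetwork V E} {A : Finset V} {e : E} :
    e ∈ G.edgesOut A ↔ ((∃ a ∈ A, a ∈ G.ends e) ∧ ∃ b, b ∉ A ∧ b ∈ G.ends e) ∨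
      (G.dangling e ∧ G.ends e ⊆ A) := by
  classical
  simp [edgesOut, edgesOpen, mem_edgesBetween]

lemma mem_edgesOut_of_mem_of_notMem {G : TensorNetwork V E} {A : Finset V} {e : E} {a b : V}
    (ha : a ∈ A) (hb : b ∉ A) (hae : a ∈ G.ends e) (hbe : b ∈ G.ends e) : e ∈ G.edgesOut A :=
  mem_edgesOut.2 (.inl ⟨⟨a, ha, hae⟩, b, hb, hbe⟩)

lemma mem_edgesOut_single {G : TensorNetwork V E} {A : Finset V} {e : E} {a : V}
    (h : ∀ y, y ∈ G.ends e ↔ y = a) (hd : G.dangling e) : e ∈ G.edgesOut A ↔ a ∈ A := by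
  simp only [mem_edgesOut, h, hd, Finset.subset_iff, exists_eq_right, forall_eq, true_and]
  tauto

lemma mem_edgesOut_pair {G : TensorNetwork V E} {A : Finset V} {e : E} {a b : V}
    (h : ∀ y, y ∈ G.ends e ↔ y = a ∨ y = b) (hd : ¬ G.dangling e) :
    e ∈ G.edgesOut A ↔ ¬ (a ∈ A ↔ b ∈ A) := by
  simp only [mem_edgesOut, h, hd, false_and, or_false, and_or_left, exists_or, exists_eq_right]
  tauto

lemma logCost_comm (G : TensorNetwork V E) (A B : Finset V) : G.logCost A B = G.logCost B A := by
  rw [logCost, logCost, cutBetween, cutBetween, edgesBetween_comm, add_comm (G.cut A)]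

lemma edgesBetween_subset_edgesOut {G : TensorNetwork V E} {A B : Finset V} (h : Disjoint A B) :
    G.edgesBetween A B ⊆ G.edgesOut A := by
  intro e he
  obtain ⟨⟨a, ha, hae⟩, b, hb, hbe⟩ := mem_edgesBetween.1 he
  exact mem_edgesOut_of_mem_of_notMem ha (Finset.disjoint_right.1 h hb) hae hbe

/-- The dimensions of both operands all occur in the cost of a contraction. -/
lemma prod_dim_le_exp_logCost (G : TensorNetwork V E) {A B : Finset V} (h : Disjoint A B)
    {Q : Finset E} (hQ : ∀ e ∈ Q, e ∈ G.edgesOut A ∨ e ∈ G.edgesOut B) :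
    ∏ e ∈ Q, ((G.dim e : ℕ) : ℝ) ≤ Real.exp (G.logCost A B) := by
  classical
  rw [← exp_sum_weight, Real.exp_le_exp]
  have h1 : ∑ e ∈ Q, G.weight e ≤ ∑ e ∈ G.edgesOut A ∪ G.edgesOut B, G.weight e :=
    Finset.sum_le_sum_of_subset_of_nonneg (fun e he => Finset.mem_union.2 (hQ e he))
      fun e _ _ => G.weight_nonneg e
  -- By disjointness an edge between `A` and `B` leaves both sets, so subtracting the mutual cut
  -- removes at most what `cut A + cut B` counts twice.
  have h2 : G.cutBetween A B ≤ ∑ e ∈ G.edgesOut A ∩ G.edgesOut B, G.weight e := by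
    refine Finset.sum_le_sum_of_subset_of_nonneg (Finset.subset_inter
      (edgesBetween_subset_edgesOut h) ?_) fun e _ _ => G.weight_nonneg e
    rw [edgesBetween_comm]
    exact edgesBetween_subset_edgesOut h.symm
  have h3 := Finset.sum_union_inter (s₁ := G.edgesOut A) (s₂ := G.edgesOut B) (f := G.weight)
  rw [logCost, cut, cut]
  linarith

/-- An upper bound for the cost of a contraction: `P` and `Q` contain the dimensions that survive
it, and `Z` those that are summed over. -/
lemma logCost_le (G : TensorNetwork V E) {A B : Finset V} {P Q Z : Finset E}
    (hP : ∀ e ∈ G.edgesOut A, e ∈ P ∨ e ∈ G.edgesBetween A B)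
    (hQ : ∀ e ∈ G.edgesOut B, e ∈ Q ∨ e ∈ G.edgesBetween A B)
    (hZ : G.edgesBetween A B ⊆ Z) :
    G.logCost A B ≤ ∑ e ∈ P, G.weight e + ∑ e ∈ Q, G.weight e + ∑ e ∈ Z, G.weight e := by
  classical
  -- Each of the two cuts contains the mutual cut, which is subtracted only once; one copy therefore
  -- remains and is bounded through `Z`.
  have key : ∀ (C : Finset V) (O : Finset E),
      (∀ e ∈ G.edgesOut C, e ∈ O ∨ e ∈ G.edgesBetween A B) →
      G.cut C ≤ ∑ e ∈ O, G.weight e + G.cutBetween A B := by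
    intro C O hO
    have h1 : G.cut C ≤ ∑ e ∈ O ∪ G.edgesBetween A B, G.weight e :=
      Finset.sum_le_sum_of_subset_of_nonneg (fun e he => Finset.mem_union.2 (hO e he))
        fun e _ _ => G.weight_nonneg e
    have h2 := Finset.sum_union_inter (s₁ := O) (s₂ := G.edgesBetween A B) (f := G.weight)
    have h3 : 0 ≤ ∑ e ∈ O ∩ G.edgesBetween A B, G.weight e :=
      Finset.sum_nonneg fun e _ => G.weight_nonneg e
    rw [cutBetween]
    linarith
  have h1 := key A P hP
  have h2 := key B Q hQ
  have h3 : G.cutBetween A B ≤ ∑ e ∈ Z, G.weight e :=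
    Finset.sum_le_sum_of_subset_of_nonneg hZ fun e _ _ => G.weight_nonneg e
  rw [logCost]
  linarith

end TensorNetwork

/-! ### Contraction trees: subtrees, separation, counting -/

namespace ContractionTree

variable {V : Type*}

lemma HasContraction.symm {T : ContractionTree V} {A B : Finset V} (h : T.HasContraction A B) :
    T.HasContraction B A := Or.symm h

lemma contraction_subset_verts {T : ContractionTree V} {p : Finset V × Finset V}
    (hp : p ∈ T.contractions) : p.1 ⊆ T.verts ∧ p.2 ⊆ T.verts := by
  classical
  induction T with
  | leaf v => simp [contractions] at hp
  | node l r ihl ihr =>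
    simp only [contractions, List.mem_cons, List.mem_append] at hp
    simp only [verts]
    rcases hp with rfl | hp | hp
    · exact ⟨fun x hx => Finset.mem_union_left _ hx, fun x hx => Finset.mem_union_right _ hx⟩
    · exact ⟨fun x hx => Finset.mem_union_left _ ((ihl hp).1 hx),
        fun x hx => Finset.mem_union_left _ ((ihl hp).2 hx)⟩
    · exact ⟨fun x hx => Finset.mem_union_right _ ((ihr hp).1 hx),
        fun x hx => Finset.mem_union_right _ ((ihr hp).2 hx)⟩

/-- Each operand of a contraction is the root of a subtree. -/
lemma HasContraction.exists_subtree {T : ContractionTree V} {A B : Finset V}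
    (h : T.HasContraction A B) :
    ∃ t : ContractionTree V, t.verts = B ∧ ∀ p ∈ t.contractions, p ∈ T.contractions := by
  induction T with
  | leaf v => simp [HasContraction, contractions] at h
  | node l r ihl ihr =>
    have hl : ∀ p ∈ l.contractions, p ∈ (node l r).contractions := fun p hp => by
      simp [contractions, hp]
    have hr : ∀ p ∈ r.contractions, p ∈ (node l r).contractions := fun p hp => by
      simp [contractions, hp]
    have h' : ((A = l.verts ∧ B = r.verts) ∨ (B = l.verts ∧ A = r.verts)) ∨
        l.HasContraction A B ∨ r.HasContraction A B := by
      simp only [HasContraction, contractions, List.mem_cons, List.mem_append,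
        Prod.mk.injEq] at h ⊢
      tauto
    rcases h' with (⟨-, rfl⟩ | ⟨rfl, -⟩) | h | h
    · exact ⟨r, rfl, hr⟩
    · exact ⟨l, rfl, hl⟩
    · obtain ⟨t, ht, ht'⟩ := ihl h
      exact ⟨t, ht, fun p hp => hl p (ht' p hp)⟩
    · obtain ⟨t, ht, ht'⟩ := ihr h
      exact ⟨t, ht, fun p hp => hr p (ht' p hp)⟩

/-- Two distinct vertices of a tree are separated by one of its contractions. -/
lemma exists_hasContraction_separating {T : ContractionTree V} {a b : V} (hab : a ≠ b)
    (ha : a ∈ T.verts) (hb : b ∈ T.verts) :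
    ∃ A B, T.HasContraction A B ∧ a ∈ A ∧ b ∈ B := by
  classical
  induction T with
  | leaf v =>
    simp only [verts, Finset.mem_singleton] at ha hb
    exact absurd (ha.trans hb.symm) hab
  | node l r ihl ihr =>
    have hself : (node l r).HasContraction l.verts r.verts := .inl (by simp [contractions])
    have hl : ∀ {A B}, l.HasContraction A B → (node l r).HasContraction A B := by
      intro A B h
      simp only [HasContraction, contractions, List.mem_cons, List.mem_append] at h ⊢
      tauto
    have hr : ∀ {A B}, r.HasContraction A B → (node l r).HasContraction A B := by
      intro A B h
      simp only [HasContraction, contractions, List.mem_cons, List.mem_append] at h ⊢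
      tauto
    -- Descend as long as both vertices are found on the same side; the node at which the sides
    -- differ separates them.
    simp only [verts, Finset.mem_union] at ha hb
    rcases ha with ha | ha <;> rcases hb with hb | hb
    · obtain ⟨A, B, h, h'⟩ := ihl ha hb
      exact ⟨A, B, hl h, h'⟩
    · exact ⟨_, _, hself, ha, hb⟩
    · exact ⟨_, _, hself.symm, ha, hb⟩
    · obtain ⟨A, B, h, h'⟩ := ihr ha hb
      exact ⟨A, B, hr h, h'⟩

lemma HasContraction.disjoint [Fintype V] {T : ContractionTree V} (hT : T.IsFull) {A B : Finset V}
    (h : T.HasContraction A B) : Disjoint A B :=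
  h.elim (fun h => hT.1 _ h) fun h => (hT.1 _ h).symm

variable {E : Type*} [Fintype V] [Fintype E]

/-- If `key` takes each value in `J` on some contraction of cost at least `c`, then the tree costs
at least `|J| c`. -/
lemma card_mul_le_cost (G : TensorNetwork V E) (T : ContractionTree V) {α : Type*} (J : Finset α)
    (key : Finset V → α) (c : ℝ)
    (h : ∀ j ∈ J, ∃ A B, T.HasContraction A B ∧ (∀ U, (∀ x, x ∈ U ↔ x ∈ A ∨ x ∈ B) → key U = j) ∧
      c ≤ Real.exp (G.logCost A B)) :
    J.card * c ≤ T.cost G := by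
  classical
  have h' : ∀ j ∈ J, ∃ p ∈ T.contractions, key (p.1 ∪ p.2) = j ∧
      c ≤ Real.exp (G.logCost p.1 p.2) := by
    intro j hj
    obtain ⟨A, B, hAB | hAB, hk, hc⟩ := h j hj
    · exact ⟨_, hAB, hk _ fun x => by simp, hc⟩
    · exact ⟨_, hAB, hk _ fun x => by simp [or_comm], by rwa [G.logCost_comm]⟩
  choose! p hp hk hc using h'
  -- The index is recovered from the union of the operands, so no contraction is charged twice.
  have hinj : Set.InjOn p J := fun i hi j hj hij => by rw [← hk i hi, ← hk j hj, hij]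
  calc J.card * c = ∑ _j ∈ J, c := by simp
    _ ≤ ∑ j ∈ J, Real.exp (G.logCost (p j).1 (p j).2) := Finset.sum_le_sum hc
    _ = ∑ q ∈ J.image p, Real.exp (G.logCost q.1 q.2) := by rw [Finset.sum_image hinj]
    _ ≤ ∑ q ∈ T.contractions.toFinset, Real.exp (G.logCost q.1 q.2) := by
        refine Finset.sum_le_sum_of_subset_of_nonneg ?_ fun _ _ _ => (Real.exp_pos _).le
        intro q hq
        obtain ⟨j, hj, rfl⟩ := Finset.mem_image.1 hq
        exact List.mem_toFinset.2 (hp j hj)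
    _ ≤ T.cost G := by
        rw [cost, Finset.sum_list_map_count]
        refine Finset.sum_le_sum fun q hq => ?_
        exact le_self_nsmul (Real.exp_pos _).le
          ((@List.count_pos_iff _ instBEqOfDecidableEq _ _ _).2 (List.mem_toFinset.1 hq)).ne'

end ContractionTree

end TNSketch

/-! ### The lower bound -/

namespace TNSketch

/-- Truncating the fold after `k` steps makes the vertex set and the contractions provable by a
joint induction; the new contraction is known only once the vertices gathered so far are. -/
lemma leftToRight_prefix (n k : ℕ) (hk : k ≤ n) :
    let t := ((List.finRange n).take k).foldl (fun t j => .node t (.leaf j.succ))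
      (.leaf 0 : ContractionTree (Fin (n + 1)))
    (∀ x, x ∈ t.verts ↔ (x : ℕ) ≤ k) ∧
      ∀ p, p ∈ t.contractions ↔ ∃ j : Fin n, (j : ℕ) < k ∧ p = (Finset.Iic j.castSucc, {j.succ}) := by
  classical
  induction k with
  | zero =>
    refine ⟨fun x => ?_, fun p => ?_⟩
    · simp only [List.take_zero, List.foldl_nil, ContractionTree.verts, Finset.mem_singleton,
        Fin.ext_iff, Fin.val_zero, Nat.le_zero]
    · simp [ContractionTree.contractions]
  | succ k ih =>
    obtain ⟨ihv, ihc⟩ := ih (by omega)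
    have hlt : k < (List.finRange n).length := by simpa using hk
    rw [List.take_succ_eq_append_getElem hlt, List.foldl_append]
    simp only [List.foldl_cons, List.foldl_nil, List.getElem_finRange]
    set t := ((List.finRange n).take k).foldl (fun t j => .node t (.leaf j.succ))
      (.leaf 0 : ContractionTree (Fin (n + 1))) with ht
    have hv : t.verts = Finset.Iic (Fin.castSucc ⟨k, hk⟩) := by
      ext x
      rw [ihv, Finset.mem_Iic, Fin.le_def]
      simp
    refine ⟨fun x => ?_, fun p => ?_⟩
    · simp only [ContractionTree.verts, Finset.mem_union, ihv, Finset.mem_singleton, Fin.ext_iff]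
      simp
      omega
    · simp only [ContractionTree.contractions, List.mem_cons, List.append_nil, ihc, hv,
        ContractionTree.verts]
      constructor
      · rintro (rfl | ⟨j, hj, rfl⟩)
        · exact ⟨⟨k, hk⟩, by simp, by simp⟩
        · exact ⟨j, by omega, rfl⟩
      · rintro ⟨j, hj, rfl⟩
        rcases Nat.lt_succ_iff_lt_or_eq.1 hj with h | h
        · exact .inr ⟨j, h, rfl⟩
        · left
          subst h
          simp

lemma mem_contractions_leftToRight {n : ℕ} {p : Finset (Fin (n + 1)) × Finset (Fin (n + 1))} :
    p ∈ (leftToRight n).contractions ↔ ∃ j : Fin n, p = (Finset.Iic j.castSucc, {j.succ}) := by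
  have h := (leftToRight_prefix n n le_rfl).2 p
  rw [List.take_of_length_le (by simp)] at h
  exact h.trans ⟨fun ⟨j, _, hj⟩ => ⟨j, hj⟩, fun ⟨j, hj⟩ => ⟨j, j.2, hj⟩⟩

section LowerBound

variable {VD VE ι P F : Type*} [Fintype VD] [Fintype VE] [Fintype ι] [Fintype P] [Fintype F]

/-- The row at the last vertex of `W` consists of dimensions leaving `W`. -/
lemma exists_row_subset_edgesOut (D : TensorNetwork VD (ι ⊕ P)) (S : TensorNetwork VE (ι ⊕ F))
    (hS : S.IsGraph) (σ : VE ≃ Fin (Fintype.card VE)) (x : ℝ)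
    (hσ : ∀ v, x ≤ rowSize S σ v) {A : Finset (VD ⊕ VE)} (hA : A.toRight.Nonempty) :
    ∃ Q : Finset F, x ≤ ∏ f ∈ Q, ((S.dim (.inr f) : ℕ) : ℝ) ∧
      ∀ f ∈ Q, (.inr (.inr f)) ∈ (glue D S).edgesOut A := by
  classical
  -- At the latest embedding vertex of `A`, an edge to a later vertex must leave `A`. An output edge
  -- at it ends nowhere else, since the embedding is a graph, so it is an open dimension of `A`.
  obtain ⟨v, hv, hmax⟩ := Finset.exists_max_image A.toRight σ hA
  refine ⟨Finset.univ.filter fun f => v ∈ S.ends (.inr f) ∧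
    (S.dangling (.inr f) ∨ ∃ x ∈ S.ends (.inr f), σ v < σ x), ?_, ?_⟩
  · refine (hσ v).trans_eq ?_
    rw [rowSize, Nat.cast_prod]
  · intro f hf
    obtain ⟨hvf, hf⟩ := (Finset.mem_filter.1 hf).2
    rw [Finset.mem_toRight] at hv
    rcases hf with hf | ⟨y, hy, hlt⟩
    · refine TensorNetwork.mem_edgesOut.2 (.inr ⟨hf, ?_⟩)
      obtain ⟨w, hw⟩ := Finset.card_eq_one.1 ((hS _).1 hf)
      rw [hw, Finset.mem_singleton] at hvf
      subst hvf
      intro z hz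
      simp only [glue, hw, Finset.mem_disjSum] at hz
      simp at hz
      rwa [← hz]
    · refine TensorNetwork.mem_edgesOut_of_mem_of_notMem hv (b := .inr y) ?_ ?_ ?_
      · intro hyA
        exact (hmax y (Finset.mem_toRight.2 hyA)).not_gt hlt
      · simpa [glue] using hvf
      · simpa [glue] using hy

end LowerBound

section TensorTrain

variable {n : ℕ} {s R m : ℕ+} {VE F : Type*} [Fintype VE] [Fintype F]
  {S : TensorNetwork VE (Fin n ⊕ F)}

/-- Sketched edges, bonds and embedding edges are of different kinds, so their contributions
multiply without double counting. It suffices that each edge leaves one of the operands. -/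
lemma pow_mul_pow_mul_prod_le_exp_logCost {A B : Finset (Fin (n + 1) ⊕ VE)} (hAB : Disjoint A B)
    {I J : Finset (Fin n)} {Q : Finset F}
    (hI : ∀ i ∈ I, .inl i ∈ (glue (ttData n s R) S).edgesOut A ∨
      .inl i ∈ (glue (ttData n s R) S).edgesOut B)
    (hJ : ∀ j ∈ J, .inr (.inl (.inl j)) ∈ (glue (ttData n s R) S).edgesOut A ∨
      .inr (.inl (.inl j)) ∈ (glue (ttData n s R) S).edgesOut B)
    (hQ : ∀ f ∈ Q, .inr (.inr f) ∈ (glue (ttData n s R) S).edgesOut A ∨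
      .inr (.inr f) ∈ (glue (ttData n s R) S).edgesOut B) :
    ((s : ℕ) : ℝ) ^ I.card * ((R : ℕ) : ℝ) ^ J.card * ∏ f ∈ Q, ((S.dim (.inr f) : ℕ) : ℝ) ≤
      Real.exp ((glue (ttData n s R) S).logCost A B) := by
  classical
  have h := (glue (ttData n s R) S).prod_dim_le_exp_logCost hAB
    (Q := I.disjSum ((J.disjSum ∅).disjSum Q)) (by
      rintro (i | (j | j) | f) he
      · exact hI i (by simpa using he)
      · exact hJ j (by simpa using he)
      · simp at he
      · exact hQ f (by simpa using he))
  simpa [Finset.prod_disjSum, glue, ttData, mul_assoc] using h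

/-- The main step of the lower bound: an expensive contraction for each interior core. -/
lemma exists_expensive_contraction (hmR : m < R) (hRs : R < s) {x : ℝ}
    (hS : IsEmbeddingFor (ttData n s R) S) (σ : VE ≃ Fin (Fintype.card VE))
    (hσ : ∀ v, x ≤ rowSize S σ v) (hx : x ≤ ((m : ℕ) : ℝ))
    {T : ContractionTree (Fin (n + 1) ⊕ VE)} (hT : IsSketchingTree (leftToRight n) T)
    {k : ℕ} (hk : 1 ≤ k) (hkn : k < n) :
    ∃ A B, T.HasContraction A B ∧
      (∀ U : Finset (Fin (n + 1) ⊕ VE), (∀ y, y ∈ U ↔ y ∈ A ∨ y ∈ B) →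
        U.toLeft.sup Fin.val = k) ∧
      ((s : ℕ) : ℝ) * ((R : ℕ) : ℝ) ^ 2 * x ≤
        Real.exp ((glue (ttData n s R) S).logCost A B) := by
  classical
  set G := glue (ttData n s R) S with hG
  set i : Fin n := ⟨k, hkn⟩ with hi
  -- Core `k` is absorbed in step `k - 1` of the data tree. Bond `j` joins it to core `k - 1`, bond
  -- `i` to core `k + 1`; both exist because `1 ≤ k < n`.
  set j : Fin n := ⟨k - 1, by omega⟩ with hj
  have hji : j ≠ i := by simp [hi, hj, Fin.ext_iff]; omega
  have hjs : j.succ = i.castSucc := by simp [hi, hj, Fin.ext_iff]; omega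
  have hsR : (0 : ℝ) ≤ ((s : ℕ) : ℝ) * ((R : ℕ) : ℝ) ^ 2 := by positivity
  obtain ⟨A, B, hAB, hA, hB⟩ := hT.2 _ _
    (.inl (mem_contractions_leftToRight.2 ⟨j, rfl⟩))
  rw [hjs] at hB
  have hdis := hAB.disjoint hT.1
  have memA : ∀ y : Fin (n + 1), .inl y ∈ A ↔ (y : ℕ) < k := fun y => by
    rw [← Finset.mem_toLeft, hA, Finset.mem_Iic, Fin.le_def]
    simp [hj]; omega
  have memB : ∀ y : Fin (n + 1), .inl y ∈ B ↔ y = i.castSucc := fun y => by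
    rw [← Finset.mem_toLeft, hB, Finset.mem_singleton]
  -- the bonds at core `i` leave every set that meets the data in this core only
  have bonds : ∀ C : Finset (Fin (n + 1) ⊕ VE), (∀ y, .inl y ∈ C ↔ y = i.castSucc) →
      ∀ b ∈ ({j, i} : Finset (Fin n)), .inr (.inl (.inl b)) ∈ G.edgesOut C := by
    intro C hC b hb
    have hiC := (hC i.castSucc).2 rfl
    rcases Finset.mem_insert.1 hb with rfl | hb
    · refine TensorNetwork.mem_edgesOut_of_mem_of_notMem hiC (b := .inl j.castSucc) ?_ ?_ ?_
      · rw [hC]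
        simpa using hji
      · simp [hG, glue, ttData, hjs]
      · simp [hG, glue, ttData]
    · rw [Finset.mem_singleton] at hb
      subst hb
      refine TensorNetwork.mem_edgesOut_of_mem_of_notMem hiC (b := .inl i.succ) ?_ ?_ ?_
      · rw [hC]
        exact (Fin.castSucc_lt_succ).ne'
      · simp [hG, glue, ttData]
      · simp [hG, glue, ttData]
  have sketch : ∀ (C : Finset (Fin (n + 1) ⊕ VE)) (l : Fin n) (w : VE), w ∈ S.ends (.inl l) →
      .inl l.castSucc ∈ C → .inr w ∉ C → .inl l ∈ G.edgesOut C := by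
    intro C l w hw hl hwC
    refine TensorNetwork.mem_edgesOut_of_mem_of_notMem hl hwC ?_ ?_
    · simp [hG, glue, ttData]
    · simpa [hG, glue] using hw
  obtain ⟨w, hw⟩ := S.ends_nonempty (.inl i)
  have hcard : ({j, i} : Finset (Fin n)).card = 2 := Finset.card_pair hji
  -- If `w` is already merged with core `k` in `B`, the expensive contraction lies below `B`, where
  -- the two are first joined; otherwise it is `(A, B)` itself.
  by_cases hwB : .inr w ∈ B
  · obtain ⟨t, htB, htT⟩ := hAB.exists_subtree
    obtain ⟨X, Y, hXY, hX, hY⟩ := ContractionTree.exists_hasContraction_separating (T := t)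
      (a := .inl i.castSucc) (b := .inr w) (by simp) (by rw [htB, memB]) (by rwa [htB])
    have hXY' : T.HasContraction X Y := hXY.imp (htT _) (htT _)
    have hdis' := hXY'.disjoint hT.1
    have hsub : X ⊆ B ∧ Y ⊆ B := by
      rw [← htB]
      rcases hXY with h | h
      · exact ContractionTree.contraction_subset_verts h
      · exact (ContractionTree.contraction_subset_verts h).symm
    have memX : ∀ y : Fin (n + 1), .inl y ∈ X ↔ y = i.castSucc := fun y =>
      ⟨fun h => (memB y).1 (hsub.1 h), fun h => h ▸ hX⟩
    have memY : ∀ y : Fin (n + 1), .inl y ∉ Y := fun y h => by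
      have hy := (memB y).1 (hsub.2 h)
      subst hy
      exact Finset.disjoint_left.1 hdis' hX h
    obtain ⟨Q, hxQ, hQ⟩ := exists_row_subset_edgesOut (ttData n s R) S hS.1 σ x hσ (A := Y)
      ⟨w, Finset.mem_toRight.2 hY⟩
    refine ⟨X, Y, hXY', fun U hU => ?_, ?_⟩
    · have : U.toLeft = {i.castSucc} := by
        ext y
        rw [Finset.mem_toLeft, hU, memX, Finset.mem_singleton]
        simp [memY]
      simp [this, hi]
    · have h := pow_mul_pow_mul_prod_le_exp_logCost (s := s) (R := R) (S := S) hdis' (I := {i})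
        (J := {j, i}) (Q := Q)
        (fun l hl => .inl (by
          rw [Finset.mem_singleton.1 hl]
          exact sketch X i w hw hX (Finset.disjoint_right.1 hdis' hY)))
        (fun b hb => .inl (bonds X memX b hb)) (fun f hf => .inr (hQ f hf))
      rw [hcard, Finset.card_singleton, pow_one] at h
      exact (mul_le_mul_of_nonneg_left hxQ hsR).trans h
  · have hkey : ∀ U : Finset (Fin (n + 1) ⊕ VE), (∀ y, y ∈ U ↔ y ∈ A ∨ y ∈ B) →
        U.toLeft.sup Fin.val = k := by
      intro U hU
      refine le_antisymm (Finset.sup_le fun y hy => ?_) ?_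
      · rw [Finset.mem_toLeft, hU, memA, memB] at hy
        rcases hy with hy | rfl
        · exact hy.le
        · simp [hi]
      · refine Finset.le_sup_of_le (b := i.castSucc) ?_ (by simp [hi])
        rw [Finset.mem_toLeft, hU, memB]
        exact .inr rfl
    have hiB := (memB i.castSucc).2 rfl
    refine ⟨A, B, hAB, hkey, ?_⟩
    -- Core `0` always lies in `A`. Either the embedding end of its sketched edge is in `A`, so that
    -- `A` exposes a row, or this edge leaves `A`. As `z ≠ i`, it is then a second factor `s`, and
    -- `x ≤ m < s`.
    set z : Fin n := ⟨0, by omega⟩ with hz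
    have hzi : z ≠ i := by simp [hz, hi, Fin.ext_iff]; omega
    obtain ⟨w₀, hw₀⟩ := S.ends_nonempty (.inl z)
    by_cases hwA : .inr w₀ ∈ A
    · obtain ⟨Q, hxQ, hQ⟩ := exists_row_subset_edgesOut (ttData n s R) S hS.1 σ x hσ (A := A)
        ⟨w₀, Finset.mem_toRight.2 hwA⟩
      have h := pow_mul_pow_mul_prod_le_exp_logCost (s := s) (R := R) (S := S) hdis (I := {i})
        (J := {j, i}) (Q := Q)
        (fun l hl => .inr (by rw [Finset.mem_singleton.1 hl]; exact sketch B i w hw hiB hwB))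
        (fun b hb => .inr (bonds B memB b hb)) (fun f hf => .inl (hQ f hf))
      rw [hcard, Finset.card_singleton, pow_one] at h
      exact (mul_le_mul_of_nonneg_left hxQ hsR).trans h
    · have h := pow_mul_pow_mul_prod_le_exp_logCost (s := s) (R := R) (S := S) hdis (I := {z, i})
        (J := {j, i}) (Q := ∅)
        (fun l hl => by
          rcases Finset.mem_insert.1 hl with rfl | hl
          · exact .inl (sketch A z w₀ hw₀ ((memA _).2 (by simp [hz]; omega)) hwA)
          · rw [Finset.mem_singleton.1 hl]
            exact .inr (sketch B i w hw hiB hwB))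
        (fun b hb => .inr (bonds B memB b hb)) (fun f hf => by simp at hf)
      rw [hcard, Finset.card_pair hzi, Finset.prod_empty, mul_one] at h
      have hxs : x ≤ ((s : ℕ) : ℝ) := hx.trans (by exact_mod_cast (hmR.trans hRs).le)
      calc _ ≤ ((s : ℕ) : ℝ) * ((R : ℕ) : ℝ) ^ 2 * ((s : ℕ) : ℝ) :=
            mul_le_mul_of_nonneg_left hxs hsR
        _ = _ := by ring
        _ ≤ _ := h

/-- The lower bound for every admissible embedding and constrained contraction tree. -/
lemma ttRate_le_cost {c₀ C₁ : ℝ} (hc₀ : 0 < c₀) (hC₁ : 0 < C₁) {ε δ : ℝ} (hn : 2 ≤ n)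
    (hmR : m < R) (hRs : R < s) (hS : Admissible c₀ C₁ ε δ m (ttData n s R) S)
    {T : ContractionTree (Fin (n + 1) ⊕ VE)} (hT : IsSketchingTree (leftToRight n) T) :
    c₀ / C₁ / 3 * ttRate n s R m ≤ T.cost (glue (ttData n s R) S) := by
  obtain ⟨hE, ⟨σ, hσ⟩, -, hlow, hup⟩ := hS
  have hm : (0 : ℝ) < ((m : ℕ) : ℝ) := by exact_mod_cast m.pos
  -- The upper bound on `m` turns the row condition into one in terms of `m` alone, which removes
  -- `N_E`, `ε` and `δ` from the estimate.
  have hle : c₀ / C₁ * ((m : ℕ) : ℝ) ≤ c₀ * accuracyScale (Fintype.card VE) ε δ := by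
    rw [div_mul_eq_mul_div, div_le_iff₀ hC₁]
    nlinarith
  have h := ContractionTree.card_mul_le_cost (glue (ttData n s R) S) T (Finset.Ico 1 n)
    (fun U => U.toLeft.sup Fin.val) (((s : ℕ) : ℝ) * ((R : ℕ) : ℝ) ^ 2 * (c₀ / C₁ * ((m : ℕ) : ℝ)))
    fun k hk => exists_expensive_contraction hmR hRs hE σ (fun v => hle.trans (hσ v))
      (hle.trans hlow) hT (Finset.mem_Ico.1 hk).1 (Finset.mem_Ico.1 hk).2
  refine le_trans ?_ h
  rw [Nat.card_Ico, Nat.cast_sub (by omega), ttRate]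
  have hn' : (2 : ℝ) ≤ n := by exact_mod_cast hn
  -- There are `n - 1` interior cores; the factor `1 / 3` is sharp at `n = 2`.
  have : ((n : ℝ) + 1) / 3 ≤ (n : ℝ) - (1 : ℕ) := by push_cast; linarith
  calc _ = ((n : ℝ) + 1) / 3 *
        (((s : ℕ) : ℝ) * ((R : ℕ) : ℝ) ^ 2 * (c₀ / C₁ * ((m : ℕ) : ℝ))) := by ring
    _ ≤ _ := mul_le_mul_of_nonneg_right this (by positivity)

end TensorTrain

end TNSketch

namespace TNSketch

/-! ### The Randomize-then-Orthogonalize tree and its cost -/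

section RandomizeThenOrthogonalize

variable {n : ℕ}

/-- The running tensor of the sketch, just before it absorbs the embedding core `j`. -/
def rtoBefore (j : Fin n) : Finset (Fin (n + 1) ⊕ Fin n) :=
  (Finset.Iic j.castSucc).disjSum (Finset.Iio j)

/-- The running tensor of the sketch, just after it has absorbed the embedding core `j`. -/
def rtoAfter (j : Fin n) : Finset (Fin (n + 1) ⊕ Fin n) :=
  (Finset.Iic j.castSucc).disjSum (Finset.Iic j)

lemma inl_mem_rtoBefore {j : Fin n} {x : Fin (n + 1)} :
    .inl x ∈ rtoBefore j ↔ (x : ℕ) ≤ j := by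
  simp [rtoBefore, Fin.le_def]

lemma inr_mem_rtoBefore {j x : Fin n} : .inr x ∈ rtoBefore j ↔ (x : ℕ) < j := by
  simp [rtoBefore]

lemma inl_mem_rtoAfter {j : Fin n} {x : Fin (n + 1)} :
    .inl x ∈ rtoAfter j ↔ (x : ℕ) ≤ j := by
  simp [rtoAfter, Fin.le_def]

lemma inr_mem_rtoAfter {j x : Fin n} : .inr x ∈ rtoAfter j ↔ (x : ℕ) ≤ j := by
  simp [rtoAfter]

/-- The same truncation as for the data tree. The length is recorded because the upper bound sums
over a list, and knowing its members does not exclude repetitions. -/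
lemma rtoTree_prefix (n k : ℕ) (hk : k ≤ n) :
    let t := ((List.finRange n).take k).foldl
      (fun t j => .node (.node t (.leaf (.inr j))) (.leaf (.inl j.succ)))
      (.leaf (.inl 0) : ContractionTree (Fin (n + 1) ⊕ Fin n))
    (∀ x : Fin (n + 1), .inl x ∈ t.verts ↔ (x : ℕ) ≤ k) ∧
      (∀ x : Fin n, .inr x ∈ t.verts ↔ (x : ℕ) < k) ∧
      (∀ p, p ∈ t.contractions ↔ ∃ j : Fin n, (j : ℕ) < k ∧
        (p = (rtoBefore j, {.inr j}) ∨ p = (rtoAfter j, {.inl j.succ}))) ∧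
      t.contractions.length = 2 * k := by
  classical
  induction k with
  | zero =>
    refine ⟨fun x => ?_, fun x => ?_, fun p => ?_, ?_⟩
    · simp only [List.take_zero, List.foldl_nil, ContractionTree.verts, Finset.mem_singleton,
        Sum.inl.injEq, Fin.ext_iff, Fin.val_zero, Nat.le_zero]
    · simp [ContractionTree.verts]
    · simp [ContractionTree.contractions]
    · simp [ContractionTree.contractions]
  | succ k ih =>
    obtain ⟨ihl, ihr, ihc, ihn⟩ := ih (by omega)
    have hlt : k < (List.finRange n).length := by simpa using hk
    rw [List.take_succ_eq_append_getElem hlt, List.foldl_append]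
    simp only [List.foldl_cons, List.foldl_nil, List.getElem_finRange]
    set t := ((List.finRange n).take k).foldl
      (fun t j => .node (.node t (.leaf (.inr j))) (.leaf (.inl j.succ)))
      (.leaf (.inl 0) : ContractionTree (Fin (n + 1) ⊕ Fin n)) with ht
    have hcast : Fin.cast (List.length_finRange (n := n)) ⟨k, hlt⟩ = (⟨k, hk⟩ : Fin n) := rfl
    simp only [hcast]
    have hv : t.verts = rtoBefore ⟨k, hk⟩ := by
      ext (x | x)
      · rw [ihl, inl_mem_rtoBefore]
      · rw [ihr, inr_mem_rtoBefore]
    have hleaf : ∀ y : Fin (n + 1) ⊕ Fin n, (ContractionTree.leaf y).verts = {y} := fun _ => rfl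
    have hv' : (ContractionTree.node t (.leaf (.inr ⟨k, hk⟩))).verts = rtoAfter ⟨k, hk⟩ := by
      ext (x | x)
      · simp [ContractionTree.verts, ihl, inl_mem_rtoAfter]
      · simp only [ContractionTree.verts, Finset.mem_union, ihr, inr_mem_rtoAfter,
          Finset.mem_singleton, Sum.inr.injEq, Fin.ext_iff]
        exact le_iff_lt_or_eq.symm
    refine ⟨fun x => ?_, fun x => ?_, fun p => ?_, ?_⟩
    · simp only [ContractionTree.verts, Finset.mem_union, ihl, Finset.mem_singleton,
        Sum.inl.injEq, Fin.ext_iff, reduceCtorEq, or_false, Fin.val_succ]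
      omega
    · simp only [ContractionTree.verts, Finset.mem_union, ihr, Finset.mem_singleton,
        Sum.inr.injEq, Fin.ext_iff, reduceCtorEq, or_false]
      omega
    · simp only [ContractionTree.contractions, List.mem_cons, List.append_nil, ihc, hleaf, hv,
        hv']
      constructor
      · rintro (rfl | rfl | ⟨j, hj, h⟩)
        · exact ⟨⟨k, hk⟩, by simp, .inr rfl⟩
        · exact ⟨⟨k, hk⟩, by simp, .inl rfl⟩
        · exact ⟨j, by omega, h⟩
      · rintro ⟨j, hj, h⟩
        rcases Nat.lt_succ_iff_lt_or_eq.1 hj with h' | rfl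
        · exact .inr (.inr ⟨j, h', h⟩)
        · exact h.elim (fun h => .inr (.inl h)) .inl
    · simp only [ContractionTree.contractions, List.length_cons, List.append_nil, ihn]
      omega

lemma rtoTree_properties (n : ℕ) :
    (∀ x, x ∈ (rtoTree n).verts) ∧
      (∀ p, p ∈ (rtoTree n).contractions ↔ ∃ j : Fin n,
        p = (rtoBefore j, {.inr j}) ∨ p = (rtoAfter j, {.inl j.succ})) ∧
      (rtoTree n).contractions.length = 2 * n := by
  obtain ⟨hl, hr, hc, hn⟩ := rtoTree_prefix n n le_rfl
  rw [List.take_of_length_le (by simp)] at hl hr hc hn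
  refine ⟨?_, fun p => (hc p).trans ⟨fun ⟨j, _, hj⟩ => ⟨j, hj⟩, fun ⟨j, hj⟩ => ⟨j, j.2, hj⟩⟩, hn⟩
  rintro (x | x)
  · exact (hl x).2 (Nat.lt_succ_iff.1 x.2)
  · exact (hr x).2 x.2

lemma isSketchingTree_rtoTree (n : ℕ) : IsSketchingTree (leftToRight n) (rtoTree n) := by
  classical
  obtain ⟨hv, hc, -⟩ := rtoTree_properties n
  refine ⟨⟨fun p hp => ?_, Finset.eq_univ_iff_forall.2 hv⟩, fun A B h => ?_⟩
  · obtain ⟨j, rfl | rfl⟩ := (hc p).1 hp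
    · simp [inr_mem_rtoBefore]
    · simp [inl_mem_rtoAfter]
  · have key : ∀ A B, (A, B) ∈ (leftToRight n).contractions →
        ∃ A' B', (rtoTree n).HasContraction A' B' ∧ A'.toLeft = A ∧ B'.toLeft = B := by
      intro A B h
      obtain ⟨j, hj⟩ := mem_contractions_leftToRight.1 h
      obtain ⟨rfl, rfl⟩ := Prod.mk.inj hj
      -- Absorbing the data core `j + 1` realizes step `j` of the data tree; the steps that absorb
      -- embedding cores have no counterpart there.
      refine ⟨_, _, .inl ((hc _).2 ⟨j, .inr rfl⟩), ?_, ?_⟩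
      · simp [rtoAfter]
      · ext x
        simp
    rcases h with h | h
    · exact key A B h
    · obtain ⟨A', B', h', hA, hB⟩ := key B A h
      exact ⟨B', A', h'.symm, hB, hA⟩

variable {s R m : ℕ+}

local notation "G" => glue (ttData n s R) (ttEmbedding n s m)

lemma mem_ends_sketch (i : Fin n) (y : Fin (n + 1) ⊕ Fin n) :
    y ∈ TensorNetwork.ends G (.inl i) ↔ y = .inl i.castSucc ∨ y = .inr i := by
  rcases y with y | y <;> simp [glue, ttData, ttEmbedding]

lemma mem_ends_bond (b : Fin n) (y : Fin (n + 1) ⊕ Fin n) :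
    y ∈ TensorNetwork.ends G (.inr (.inl (.inl b))) ↔
      y = .inl b.castSucc ∨ y = .inl b.succ := by
  rcases y with y | y <;> simp [glue, ttData]

lemma mem_ends_open (y : Fin (n + 1) ⊕ Fin n) :
    y ∈ TensorNetwork.ends G (.inr (.inl (.inr ()))) ↔ y = .inl (Fin.last n) := by
  rcases y with y | y <;> simp [glue, ttData]

lemma mem_ends_embedding {f : Fin n} (hf : (f : ℕ) + 1 < n) (y : Fin (n + 1) ⊕ Fin n) :
    y ∈ TensorNetwork.ends G (.inr (.inr f)) ↔ y = .inr f ∨ y = .inr ⟨f + 1, hf⟩ := by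
  rcases y with y | y
  · simp [glue]
  · simp [glue, ttEmbedding]
    simp [Fin.ext_iff]

lemma mem_ends_output {f : Fin n} (hf : (f : ℕ) + 1 = n) (y : Fin (n + 1) ⊕ Fin n) :
    y ∈ TensorNetwork.ends G (.inr (.inr f)) ↔ y = .inr f := by
  rcases y with y | y
  · simp [glue]
  · simp [glue, ttEmbedding]
    omega

/-- Absorbing an embedding core costs at most `s R² m`. -/
lemma exp_logCost_rtoBefore_le (hmR : m < R) (j : Fin n) :
    Real.exp (TensorNetwork.logCost G (rtoBefore j) {.inr j}) ≤
      ((s : ℕ) : ℝ) * ((R : ℕ) : ℝ) ^ 2 * ((m : ℕ) : ℝ) := by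
  classical
  have hm : (1 : ℝ) ≤ ((m : ℕ) : ℝ) := by exact_mod_cast m.pos
  have hR : (1 : ℝ) ≤ ((R : ℕ) : ℝ) := by exact_mod_cast R.pos
  have hs : (1 : ℝ) ≤ ((s : ℕ) : ℝ) := by exact_mod_cast s.pos
  -- The contraction keeps a bond `R` and an embedding edge `m`, and sums over `s` and a second `m`;
  -- this second `m` is traded for `R`.
  have hlog : Real.log ((m : ℕ) : ℝ) ≤ Real.log ((R : ℕ) : ℝ) :=
    Real.log_le_log (by positivity) (by exact_mod_cast hmR.le)
  obtain ⟨Z, hZ, hZw⟩ : ∃ Z : Finset (Fin n ⊕ ((Fin n ⊕ Unit) ⊕ Fin n)),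
      (.inl j ∈ Z ∧ ∀ f : Fin n, (f : ℕ) + 1 = j → .inr (.inr f) ∈ Z) ∧
      ∑ e ∈ Z, TensorNetwork.weight G e ≤ Real.log ((s : ℕ) : ℝ) + Real.log ((m : ℕ) : ℝ) := by
    -- The first embedding core has no predecessor, so only the sketched edge is summed over.
    by_cases hj : (j : ℕ) = 0
    · refine ⟨{.inl j}, ⟨by simp, fun f hf => by omega⟩, ?_⟩
      rw [Finset.sum_singleton]
      exact le_add_of_nonneg_right (Real.log_nonneg hm)
    · refine ⟨{.inl j, .inr (.inr ⟨j - 1, by omega⟩)}, ⟨by simp, fun f hf => ?_⟩, ?_⟩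
      · simp [Fin.ext_iff]
        omega
      · rw [Finset.sum_pair (by simp)]
        exact le_rfl
  have h := TensorNetwork.logCost_le G (A := rtoBefore j) (B := {.inr j})
    (P := {.inr (.inl (.inl j))}) (Q := {.inr (.inr j)}) (Z := Z) (by
      rintro (i | (b | u) | f)
      · rw [TensorNetwork.mem_edgesOut_pair (mem_ends_sketch i) not_false,
          TensorNetwork.mem_edgesBetween_pair (mem_ends_sketch i)]
        simp [inl_mem_rtoBefore, inr_mem_rtoBefore, Fin.ext_iff]
        omega
      · rw [TensorNetwork.mem_edgesOut_pair (mem_ends_bond b) not_false,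
          TensorNetwork.mem_edgesBetween_pair (mem_ends_bond b)]
        simp [inl_mem_rtoBefore, Fin.ext_iff]
        omega
      · rw [TensorNetwork.mem_edgesOut_single mem_ends_open trivial]
        simp [inl_mem_rtoBefore]
      · rcases (Nat.succ_le_of_lt f.2).lt_or_eq with hf | hf
        · rw [TensorNetwork.mem_edgesOut_pair (mem_ends_embedding hf) hf.ne,
            TensorNetwork.mem_edgesBetween_pair (mem_ends_embedding hf)]
          simp [inr_mem_rtoBefore, Fin.ext_iff]
          omega
        · rw [TensorNetwork.mem_edgesOut_single (mem_ends_output hf) hf]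
          simp [inr_mem_rtoBefore]
          omega) (by
      rintro (i | (b | u) | f)
      · rw [TensorNetwork.mem_edgesOut_pair (mem_ends_sketch i) not_false,
          TensorNetwork.mem_edgesBetween_pair (mem_ends_sketch i)]
        simp [inl_mem_rtoBefore, inr_mem_rtoBefore, Fin.ext_iff]
        omega
      · rw [TensorNetwork.mem_edgesOut_pair (mem_ends_bond b) not_false]
        simp
      · rw [TensorNetwork.mem_edgesOut_single mem_ends_open trivial]
        simp
      · rcases (Nat.succ_le_of_lt f.2).lt_or_eq with hf | hf
        · rw [TensorNetwork.mem_edgesOut_pair (mem_ends_embedding hf) hf.ne,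
            TensorNetwork.mem_edgesBetween_pair (mem_ends_embedding hf)]
          simp [inr_mem_rtoBefore, Fin.ext_iff]
          omega
        · rw [TensorNetwork.mem_edgesOut_single (mem_ends_output hf) hf]
          simp
          exact fun h => .inl h) (by
      rintro (i | (b | u) | f)
      · rw [TensorNetwork.mem_edgesBetween_pair (mem_ends_sketch i)]
        simp only [Finset.mem_singleton, reduceCtorEq, Sum.inr.injEq, false_or, and_imp]
        rintro - rfl
        exact hZ.1
      · rw [TensorNetwork.mem_edgesBetween_pair (mem_ends_bond b)]
        simp
      · rw [TensorNetwork.mem_edgesBetween_single mem_ends_open]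
        simp
      · rcases (Nat.succ_le_of_lt f.2).lt_or_eq with hf | hf
        · rw [TensorNetwork.mem_edgesBetween_pair (mem_ends_embedding hf)]
          simp only [inr_mem_rtoBefore, Finset.mem_singleton, Sum.inr.injEq, Fin.ext_iff]
          exact fun h => hZ.2 f (by omega)
        · rw [TensorNetwork.mem_edgesBetween_single (mem_ends_output hf)]
          simp only [inr_mem_rtoBefore, Finset.mem_singleton, Sum.inr.injEq, Fin.ext_iff]
          omega)
  rw [Finset.sum_singleton, Finset.sum_singleton] at h
  have h1 : TensorNetwork.weight G (.inr (.inl (.inl j))) = Real.log ((R : ℕ) : ℝ) := rfl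
  have h2 : TensorNetwork.weight G (.inr (.inr j)) = Real.log ((m : ℕ) : ℝ) := rfl
  rw [← Real.le_log_iff_exp_le (by positivity), Real.log_mul (by positivity) (by positivity),
    Real.log_mul (by positivity) (by positivity), Real.log_pow]
  push_cast
  linarith

/-- Absorbing a data core costs at most `s R² m`. -/
lemma exp_logCost_rtoAfter_le (j : Fin n) :
    Real.exp (TensorNetwork.logCost G (rtoAfter j) {.inl j.succ}) ≤
      ((s : ℕ) : ℝ) * ((R : ℕ) : ℝ) ^ 2 * ((m : ℕ) : ℝ) := by
  classical
  have hm : (1 : ℝ) ≤ ((m : ℕ) : ℝ) := by exact_mod_cast m.pos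
  have hR : (1 : ℝ) ≤ ((R : ℕ) : ℝ) := by exact_mod_cast R.pos
  have hs : (1 : ℝ) ≤ ((s : ℕ) : ℝ) := by exact_mod_cast s.pos
  obtain ⟨Q, ⟨hQs, hQb, hQo⟩, hQw⟩ : ∃ Q : Finset (Fin n ⊕ ((Fin n ⊕ Unit) ⊕ Fin n)),
      ((∀ i : Fin n, (i : ℕ) = j + 1 → .inl i ∈ Q) ∧
        (∀ b : Fin n, (b : ℕ) = j + 1 → .inr (.inl (.inl b)) ∈ Q) ∧
        ((j : ℕ) + 1 = n → .inr (.inl (.inr ())) ∈ Q)) ∧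
      ∑ e ∈ Q, TensorNetwork.weight G e ≤ Real.log ((s : ℕ) : ℝ) + Real.log ((R : ℕ) : ℝ) := by
    -- The last data core has no further bond, and its open edge takes the place of the sketched
    -- one.
    by_cases hj : (j : ℕ) + 1 = n
    · refine ⟨{.inr (.inl (.inr ()))}, ⟨fun i _ => by omega, fun b _ => by omega, by simp⟩, ?_⟩
      rw [Finset.sum_singleton]
      exact le_add_of_nonneg_right (Real.log_nonneg hR)
    · refine ⟨{.inl ⟨j + 1, by omega⟩, .inr (.inl (.inl ⟨j + 1, by omega⟩))},
        ⟨fun i hi => ?_, fun b hb => ?_, fun h => absurd h hj⟩, ?_⟩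
      · simp [Fin.ext_iff, hi]
      · simp [Fin.ext_iff, hb]
      · rw [Finset.sum_pair (by simp)]
        exact le_rfl
  have h := TensorNetwork.logCost_le G (A := rtoAfter j) (B := {.inl j.succ})
    (P := {.inr (.inr j)}) (Q := Q) (Z := {.inr (.inl (.inl j))}) (by
      rintro (i | (b | u) | f)
      · rw [TensorNetwork.mem_edgesOut_pair (mem_ends_sketch i) not_false]
        simp [inl_mem_rtoAfter, inr_mem_rtoAfter]
      · rw [TensorNetwork.mem_edgesOut_pair (mem_ends_bond b) not_false,
          TensorNetwork.mem_edgesBetween_pair (mem_ends_bond b)]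
        simp [inl_mem_rtoAfter, Fin.ext_iff]
        omega
      · rw [TensorNetwork.mem_edgesOut_single mem_ends_open trivial]
        simp [inl_mem_rtoAfter]
      · rcases (Nat.succ_le_of_lt f.2).lt_or_eq with hf | hf
        · rw [TensorNetwork.mem_edgesOut_pair (mem_ends_embedding hf) hf.ne]
          simp [inr_mem_rtoAfter, Fin.ext_iff]
          omega
        · rw [TensorNetwork.mem_edgesOut_single (mem_ends_output hf) hf]
          simp [inr_mem_rtoAfter, Fin.ext_iff]
          omega) (by
      rintro (i | (b | u) | f)
      · rw [TensorNetwork.mem_edgesOut_pair (mem_ends_sketch i) not_false]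
        simp only [Finset.mem_singleton, reduceCtorEq, Sum.inl.injEq, Fin.ext_iff,
          Fin.val_castSucc, Fin.val_succ]
        exact fun h => .inl (hQs i (by tauto))
      · rw [TensorNetwork.mem_edgesOut_pair (mem_ends_bond b) not_false,
          TensorNetwork.mem_edgesBetween_pair (mem_ends_bond b)]
        simp only [inl_mem_rtoAfter, Finset.mem_singleton, Sum.inl.injEq, Fin.ext_iff,
          Fin.val_castSucc, Fin.val_succ]
        intro h
        by_cases hb : (b : ℕ) = j + 1
        · exact .inl (hQb b hb)
        · right
          omega
      · rw [TensorNetwork.mem_edgesOut_single mem_ends_open trivial]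
        simp only [Finset.mem_singleton, Sum.inl.injEq, Fin.ext_iff, Fin.val_last, Fin.val_succ]
        exact fun h => .inl (hQo h.symm)
      · rcases (Nat.succ_le_of_lt f.2).lt_or_eq with hf | hf
        · rw [TensorNetwork.mem_edgesOut_pair (mem_ends_embedding hf) hf.ne]
          simp
        · rw [TensorNetwork.mem_edgesOut_single (mem_ends_output hf) hf]
          simp) (by
      rintro (i | (b | u) | f)
      · rw [TensorNetwork.mem_edgesBetween_pair (mem_ends_sketch i)]
        simp [inl_mem_rtoAfter, inr_mem_rtoAfter, Fin.ext_iff]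
        omega
      · rw [TensorNetwork.mem_edgesBetween_pair (mem_ends_bond b)]
        simp [inl_mem_rtoAfter, Fin.ext_iff]
        omega
      · rw [TensorNetwork.mem_edgesBetween_single mem_ends_open]
        simp [inl_mem_rtoAfter]
      · rcases (Nat.succ_le_of_lt f.2).lt_or_eq with hf | hf
        · rw [TensorNetwork.mem_edgesBetween_pair (mem_ends_embedding hf)]
          simp
        · rw [TensorNetwork.mem_edgesBetween_single (mem_ends_output hf)]
          simp)
  rw [Finset.sum_singleton, Finset.sum_singleton] at h
  have h1 : TensorNetwork.weight G (.inr (.inl (.inl j))) = Real.log ((R : ℕ) : ℝ) := rfl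
  have h2 : TensorNetwork.weight G (.inr (.inr j)) = Real.log ((m : ℕ) : ℝ) := rfl
  rw [← Real.le_log_iff_exp_le (by positivity), Real.log_mul (by positivity) (by positivity),
    Real.log_mul (by positivity) (by positivity), Real.log_pow]
  push_cast
  linarith

lemma rtoCost_le_ttRate (hmR : m < R) : rtoCost n s R m ≤ 2 * ttRate n s R m := by
  obtain ⟨-, hc, hlen⟩ := rtoTree_properties n
  have h := List.sum_le_card_nsmul
    ((rtoTree n).contractions.map fun p => Real.exp (TensorNetwork.logCost G p.1 p.2))
    (((s : ℕ) : ℝ) * ((R : ℕ) : ℝ) ^ 2 * ((m : ℕ) : ℝ)) (by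
      intro x hx
      obtain ⟨p, hp, rfl⟩ := List.mem_map.1 hx
      obtain ⟨j, rfl | rfl⟩ := (hc p).1 hp
      · exact exp_logCost_rtoBefore_le hmR j
      · exact exp_logCost_rtoAfter_le j)
  rw [List.length_map, hlen, nsmul_eq_mul] at h
  refine h.trans ?_
  rw [ttRate]
  have : (0 : ℝ) ≤ ((s : ℕ) : ℝ) * ((R : ℕ) : ℝ) ^ 2 * ((m : ℕ) : ℝ) := by positivity
  push_cast
  linarith

end RandomizeThenOrthogonalize

/-! ### Admissibility of the train embedding and the final bounds -/

lemma admissible_ttEmbedding {c₀ C₁ : ℝ} {n : ℕ} {s R m : ℕ+} {ε δ : ℝ} (hn : 2 ≤ n)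
    (hlow : c₀ * accuracyScale n ε δ ≤ ((m : ℕ) : ℝ))
    (hup : ((m : ℕ) : ℝ) ≤ C₁ * accuracyScale n ε δ) :
    Admissible c₀ C₁ ε δ m (ttData n s R) (ttEmbedding n s m) := by
  classical
  have hends : ∀ j x : Fin n, x ∈ (ttEmbedding n s m).ends (.inr j) ↔
      x = j ∨ (x : ℕ) = j + 1 := fun j x => by simp [ttEmbedding]
  refine ⟨⟨?_, fun i => ⟨trivial, rfl⟩⟩, ⟨finCongr (Fintype.card_fin n).symm, fun v => ?_⟩,
    ⟨⟨n - 1, by omega⟩, rfl, fun f => ?_⟩, by rwa [Fintype.card_fin], by rwa [Fintype.card_fin]⟩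
  · rintro (j | j)
    · exact ⟨fun _ => Finset.card_singleton j, fun h => absurd trivial h⟩
    · refine ⟨fun h => Finset.card_eq_one.2 ⟨j, ?_⟩, fun h => ?_⟩
      · change (j : ℕ) + 1 = n at h
        ext x
        rw [hends, Finset.mem_singleton, or_iff_left]
        omega
      · have hj : (j : ℕ) + 1 < n := lt_of_le_of_ne j.2 h
        refine Finset.card_eq_two.2 ⟨j, ⟨j + 1, hj⟩, by simp [Fin.ext_iff], ?_⟩
        ext x
        rw [hends]
        simp [Fin.ext_iff]
  · have hcard : accuracyScale (Fintype.card (Fin n)) ε δ = accuracyScale n ε δ := by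
      rw [Fintype.card_fin]
    rw [hcard]
    refine hlow.trans ?_
    rw [Nat.cast_le, rowSize]
    -- In the natural order, edge `v` belongs to the row at `v`: it leads to the next core or is the
    -- output. One factor `m` is enough.
    refine Nat.le_of_dvd (Finset.prod_pos fun f _ => PNat.pos _) ?_
    refine Finset.dvd_prod_of_mem (fun f => ((ttEmbedding n s m).dim (.inr f) : ℕ)) (a := v) ?_
    simp only [Finset.mem_filter, Finset.mem_univ, true_and]
    refine ⟨(hends v v).2 (.inl rfl), ?_⟩
    by_cases h : (v : ℕ) + 1 = n
    · exact .inl h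
    · exact .inr ⟨⟨v + 1, by omega⟩, (hends _ _).2 (.inr rfl), by simp [Fin.lt_def]⟩
  · change (f : ℕ) + 1 = n ↔ _
    rw [Fin.ext_iff]
    simp only
    omega

/-- The cost does not involve `ε` and `δ`, so they may be chosen to make the train admissible with
`c₀ = C₁ = 1`, and the general lower bound applies. -/
lemma ttRate_le_rtoCost {n : ℕ} {s R m : ℕ+} (hn : 2 ≤ n) (hmR : m < R) (hRs : R < s) :
    1 / 3 * ttRate n s R m ≤ rtoCost n s R m := by
  have hn' : (0 : ℝ) < n := by exact_mod_cast (by omega : 0 < n)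
  -- With `ε = 1 / 2` the scale is `4 n log (1 / δ)`, and `δ` is solved for so that it equals `m`
  -- exactly.
  have hscale : accuracyScale n (1 / 2) (Real.exp (-(((m : ℕ) : ℝ) / (4 * n)))) = ((m : ℕ) : ℝ) := by
    rw [accuracyScale, one_div (Real.exp _), ← Real.exp_neg, Real.log_exp]
    field_simp
    norm_num
  have h := ttRate_le_cost one_pos one_pos hn hmR hRs
    (admissible_ttEmbedding (c₀ := 1) (C₁ := 1) (s := s) (R := R) hn
      (by rw [hscale, one_mul]) (by rw [hscale, one_mul])) (isSketchingTree_rtoTree n)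
  rwa [div_one] at h

end TNSketch

open TNSketch in
theorem mainTheorem11 :
    -- lower bound for all admissible embeddings and all constrained contraction trees
    (∀ c₀ C₁ : ℝ, 0 < c₀ → 0 < C₁ → ∃ c : ℝ, 0 < c ∧
      ∀ (n : ℕ) (s R m : ℕ+) (ε δ : ℝ), 2 ≤ n → m < R → R < s →
        0 < ε → ε < 1 → 0 < δ → δ < 1 →
        ∀ (VE : Type u) (F : Type v) [Fintype VE] [Fintype F]
          (S : TensorNetwork VE (Fin n ⊕ F)), Admissible c₀ C₁ ε δ m (ttData n s R) S →
        ∀ T : ContractionTree (Fin (n + 1) ⊕ VE), IsSketchingTree (leftToRight n) T →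
          c * ttRate n s R m ≤ T.cost (glue (ttData n s R) S)) ∧
    -- the Randomize-then-Orthogonalize sketch is constrained on the same tree and costs Θ(N s R² m)
    (∃ b B : ℝ, 0 < b ∧ 0 < B ∧
      ∀ (n : ℕ) (s R m : ℕ+), 2 ≤ n → m < R → R < s →
        IsSketchingTree (leftToRight n) (rtoTree n) ∧
        b * ttRate n s R m ≤ rtoCost n s R m ∧ rtoCost n s R m ≤ B * ttRate n s R m) ∧
    -- its embedding is admissible for every sketch size m = Θ(N_E log(1/δ) / ε²), N_E = n
    (∀ (c₀ C₁ : ℝ) (n : ℕ) (s R m : ℕ+) (ε δ : ℝ), 0 < c₀ → 0 < C₁ → 2 ≤ n → m < R → R < s →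
        0 < ε → ε < 1 → 0 < δ → δ < 1 →
        c₀ * accuracyScale n ε δ ≤ ((m : ℕ) : ℝ) → ((m : ℕ) : ℝ) ≤ C₁ * accuracyScale n ε δ →
        Admissible c₀ C₁ ε δ m (ttData n s R) (ttEmbedding n s m)) ∧
    -- hence it is optimal up to a constant factor among all admissible sketches of size m
    (∀ c₀ C₁ : ℝ, 0 < c₀ → 0 < C₁ → ∃ K : ℝ, 0 < K ∧
      ∀ (n : ℕ) (s R m : ℕ+) (ε δ : ℝ), 2 ≤ n → m < R → R < s →
        0 < ε → ε < 1 → 0 < δ → δ < 1 →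
        ∀ (VE : Type u) (F : Type v) [Fintype VE] [Fintype F]
          (S : TensorNetwork VE (Fin n ⊕ F)), Admissible c₀ C₁ ε δ m (ttData n s R) S →
        ∀ T : ContractionTree (Fin (n + 1) ⊕ VE), IsSketchingTree (leftToRight n) T →
          rtoCost n s R m ≤ K * T.cost (glue (ttData n s R) S)) := by
  refine ⟨fun c₀ C₁ hc₀ hC₁ => ⟨c₀ / C₁ / 3, by positivity, ?_⟩,
    ⟨1 / 3, 2, by norm_num, by norm_num, fun n s R m hn hmR hRs =>
      ⟨isSketchingTree_rtoTree n, ttRate_le_rtoCost hn hmR hRs, rtoCost_le_ttRate hmR⟩⟩,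
    fun c₀ C₁ n s R m ε δ _ _ hn _ _ _ _ _ _ hlow hup => admissible_ttEmbedding hn hlow hup,
    -- `K` is the upper constant `2` of the sketch over the universal lower constant.
    fun c₀ C₁ hc₀ hC₁ => ⟨2 / (c₀ / C₁ / 3), by positivity, ?_⟩⟩
  · intro n s R m ε δ hn hmR hRs _ _ _ _ VE F _ _ S hS T hT
    exact ttRate_le_cost hc₀ hC₁ hn hmR hRs hS hT
  · intro n s R m ε δ hn hmR hRs _ _ _ _ VE F _ _ S hS T hT
    have hc : 0 < c₀ / C₁ / 3 := by positivity
    have h := ttRate_le_cost hc₀ hC₁ hn hmR hRs hS hT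
    refine (rtoCost_le_ttRate hmR).trans ?_
    rw [div_mul_eq_mul_div, le_div_iff₀ hc]
    linarith
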